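/- Let $\delta(*)$ be a (nonzero) limit ordinal and let $\lambda$ be a cardinal with $\lambda=\mathrm{cf}(\lambda)>|\delta(*)|^{+}$. For a set $C$ of ordinals, $\mathrm{otp}(C)$ denotes its order type and $\mathrm{nacc}(C)$ denotes the set of those $\beta\in C$ that are not accumulation points of $C$ (that is, $\beta = 0$ or $\sup(C\cap\beta)<\beta$). A club of a limit ordinal $\delta$ is a closed unbounded subset of $\delta$. Then there are a stationary set $S\subseteq\{\delta<\lambda:\mathrm{cf}(\delta)=\mathrm{cf}(\delta(*))\}$ and sequences $\langle\mathcal P^*_{1,\alpha}:\alpha<\lambda\rangle$ and $\langle\mathcal P^*_{2,\alpha}:\alpha<\lambda\rangle$ such that: (A) for every $\alpha<\lambda$, $\mathcal P^*_{1,\alpha}$ is a family of fewer than $\lambda$ closed subsets of $\alpha$, each of order type $<\delta(*)$; (B) if $\alpha<\lambda$, $C\in\mathcal P^*_{1,\alpha}$ and $\beta\in\mathrm{nacc}(C)$, then $C\cap\beta\in\mathcal P^*_{1,\beta}$; (C) for every $\delta<\lambda$, $\mathcal P^*_{2,\delta}$ is a (possibly empty) family of at most $\lambda$ clubs of $\delta$,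 each of order type $\delta(*)$, and if $C\in\mathcal P^*_{2,\delta}$ and $\beta\in\mathrm{nacc}(C)$, then $C\cap\beta\in\mathcal P^*_{1,\beta}$ (in particular $\mathcal P^*_{2,\delta}=\emptyset$ unless $\delta$ is a limit ordinal with $\mathrm{cf}(\delta)=\mathrm{cf}(\delta(*))$); (D) for every club $E$ of $\lambda$ there is $\delta\in E\cap S$ such that $\mathrm{cf}(\delta)=\mathrm{cf}(\delta(*))$ and some $C\in\mathcal P^*_{2,\delta}$ satisfies $C\subseteq E$. -/

import Mathlib

open Cardinal Ordinal Order Set Topology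
open scoped Filter

universe u

/-- The order type of a set of ordinals. It lives one universe up: for a bounded set `C` it is
the lift of an ordinal of the original universe. -/
noncomputable def otp (C : Set Ordinal.{u}) : Ordinal.{u + 1} :=
  Ordinal.type (fun a b : C => a < b)

/-- `C` is a closed subset of the ordinal `α = {β | β < α}` (order topology of `α`). -/
def IsClosedSubset (C : Set Ordinal.{u}) (α : Ordinal.{u}) : Prop :=
  C ⊆ Iio α ∧ IsClosed (Subtype.val ⁻¹' C : Set (Iio α))

/-- `C` is a club (closed unbounded subset) of the ordinal `α`. -/
def IsClubOf (C : Set Ordinal.{u}) (α : Ordinal.{u}) : Prop :=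
  C ⊆ Iio α ∧ IsClub (Subtype.val ⁻¹' C : Set (Iio α))

/-- `S` is a stationary subset of the ordinal `α`. -/
def IsStationaryIn (S : Set Ordinal.{u}) (α : Ordinal.{u}) : Prop :=
  S ⊆ Iio α ∧ IsStationary (Subtype.val ⁻¹' S : Set (Iio α))

/-- `nacc(C)`: the points of `C` that are not accumulation points of `C`. -/
def nacc (C : Set Ordinal.{u}) : Set Ordinal.{u} :=
  {β ∈ C | ¬ AccPt β (𝓟 C)}

/-- The club guessing property of the families `⟨P₁ α : α < lam⟩`, `⟨P₂ α : α < lam⟩` on `S`, with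
guessing clubs of order type `δs`. The ordinals below the cardinal `lam` are those below `lam.ord`;
the values of `P₁`, `P₂` elsewhere play no role. -/
structure GuessingFamilies (lam : Cardinal.{u}) (δs : Ordinal.{u}) (S : Set Ordinal.{u})
    (P₁ P₂ : Ordinal.{u} → Set (Set Ordinal.{u})) : Prop where
  /-- `P₁ α` has fewer than `lam` members. -/
  card_fst : ∀ α < lam.ord, #(P₁ α) < Cardinal.lift.{u + 1} lam
  /-- The members of `P₁ α` are closed subsets of `α`. -/
  closed_fst : ∀ α < lam.ord, ∀ C ∈ P₁ α, IsClosedSubset C α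
  /-- The members of `P₁ α` have order type less than `δs`. -/
  otp_fst : ∀ α < lam.ord, ∀ C ∈ P₁ α, otp C < Ordinal.lift.{u + 1} δs
  /-- Coherence of `P₁` at non-accumulation points. -/
  coherent_fst : ∀ α < lam.ord, ∀ C ∈ P₁ α, ∀ β ∈ nacc C, C ∩ Iio β ∈ P₁ β
  /-- `P₂ δ` has at most `lam` members. -/
  card_snd : ∀ δ < lam.ord, #(P₂ δ) ≤ Cardinal.lift.{u + 1} lam
  /-- The members of `P₂ δ` are clubs of `δ`. -/
  club_snd : ∀ δ < lam.ord, ∀ C ∈ P₂ δ, IsClubOf C δ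
  /-- The members of `P₂ δ` have order type `δs`. -/
  otp_snd : ∀ δ < lam.ord, ∀ C ∈ P₂ δ, otp C = Ordinal.lift.{u + 1} δs
  /-- Proper initial segments of members of `P₂ δ` at non-accumulation points are in `P₁`. -/
  coherent_snd : ∀ δ < lam.ord, ∀ C ∈ P₂ δ, ∀ β ∈ nacc C, C ∩ Iio β ∈ P₁ β
  /-- Every club of `lam` is guessed at a point of `S`. -/
  guess : ∀ E : Set Ordinal.{u}, IsClubOf E lam.ord →
    ∃ δ ∈ E ∩ S, δ.cof = δs.cof ∧ ∃ C ∈ P₂ δ, C ⊆ E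

/-! Put μ = |δ(*)|⁺, a regular uncountable cardinal above δ(*). By `exists_guessingFamilies` it is
enough to find small families `R β` and one family `W` such that every club contains a member of `W`
all of whose relevant initial segments lie in the `R β`.

If λ = μ⁺, each β < λ is exhausted by μ small approximations. Replace an approximation by the last
points of a club E below its elements, select δ(*) many by position, and take the closure. If this
fails for every E, each E has a club `G E` witnessing the failure. Iterate to a decreasing chain `F
ζ`. Some approximation of a suitable δ is coherent and closed under last points of `F μ.ord`. Last
points stabilize along the chain, so some `F ζ` with ζ < μ already computes the same set, which lies
in `G (F ζ)`: a contradiction.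

If λ > μ⁺, guess on τ = μ⁺ and copy the guesses along a normal sequence of length τ in the given
club. A fixed enumeration of its supremum agrees with that sequence on a club of τ. The sequence
grows fast enough to pass the stage at which each needed initial segment appears. -/

/-! ### Order-theoretic forms of accumulation point, closed subset and club. -/

theorem accPt_iff {a : Ordinal.{u}} {s : Set Ordinal.{u}} :
    AccPt a (𝓟 s) ↔ a ≠ 0 ∧ ∀ b < a, ∃ y ∈ s, b < y ∧ y < a := by
  rw [SuccOrder.accPt_principal]
  constructor
  · rintro ⟨h1, h2⟩
    refine ⟨by simpa [isMin_iff_eq_bot] using h1, fun b hb => ?_⟩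
    obtain ⟨y, hy⟩ := h2 b hb
    exact ⟨y, hy.1, hy.2.1, hy.2.2⟩
  · rintro ⟨h1, h2⟩
    refine ⟨by simpa [isMin_iff_eq_bot] using h1, fun b hb => ?_⟩
    obtain ⟨y, hy, h⟩ := h2 b hb
    exact ⟨y, hy, h⟩

theorem isClosedSubset_iff {C : Set Ordinal.{u}} {α : Ordinal.{u}} :
    IsClosedSubset C α ↔ C ⊆ Iio α ∧ ∀ x < α, AccPt x (𝓟 C) → x ∈ C := by
  refine and_congr_right fun hC => ?_
  rw [← closure_subset_iff_isClosed, IsInducing.subtypeVal.closure_eq_preimage_closure_image,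
    Subtype.image_preimage_coe, inter_eq_right.2 hC, closure_eq_self_union_derivedSet]
  constructor
  · intro h x hx hacc
    exact h (show (⟨x, hx⟩ : Iio α) ∈ _ from Or.inr hacc)
  · rintro h x (hx | hx)
    · exact hx
    · exact h x x.2 hx

theorem isClubOf_iff {C : Set Ordinal.{u}} {α : Ordinal.{u}} :
    IsClubOf C α ↔
      C ⊆ Iio α ∧ (∀ x < α, AccPt x (𝓟 C) → x ∈ C) ∧ ∀ a < α, ∃ b ∈ C, a ≤ b := by
  refine and_congr_right fun hC => ?_
  rw [isClub_iff]
  refine and_congr ?_ ?_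
  · constructor
    · intro h x hx hacc
      rw [accPt_iff] at hacc
      have := @h {y | (y : Ordinal) ∈ C ∧ (y : Ordinal) < x} (fun y hy => hy.1) ?_ (.of_linearOrder _)
        ⟨x, hx⟩ ?_
      · exact this
      · obtain ⟨y, hy, h1, h2⟩ := hacc.2 0 (pos_iff_ne_zero.2 hacc.1)
        exact ⟨⟨y, hC hy⟩, hy, h2⟩
      · refine ⟨fun y hy => hy.2.le, fun z hz => ?_⟩
        by_contra! hlt
        obtain ⟨y, hy, h1, h2⟩ := hacc.2 z hlt
        exact absurd (hz (show (⟨y, hC hy⟩ : Iio α) ∈ _ from ⟨hy, h2⟩)) (not_le.2 h1)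
    · intro h t ht hne _ a ha
      by_cases hat : a ∈ t
      · exact ht hat
      have hlt : ∀ y ∈ t, y < a := fun y hy => lt_of_le_of_ne (ha.1 hy) (by grind)
      refine h a a.2 (accPt_iff.2 ⟨?_, fun b hb => ?_⟩)
      · obtain ⟨y, hy⟩ := hne
        exact (pos_of_gt (show (y : Ordinal) < a from hlt y hy)).ne'
      · by_contra! hcon
        refine absurd (ha.2 (show (⟨b, hb.trans a.2⟩ : Iio α) ∈ upperBounds t from ?_)) (not_le.2 hb)
        intro y hy
        by_contra! hby
        exact absurd (hlt y hy) (not_lt.2 (hcon y (ht hy) hby))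
  · constructor
    · intro h a ha
      obtain ⟨b, hb, hab⟩ := h ⟨a, ha⟩
      exact ⟨b, hb, hab⟩
    · rintro h ⟨a, ha⟩
      obtain ⟨b, hb, hab⟩ := h a ha
      exact ⟨⟨b, hC hb⟩, hb, hab⟩

/-! ### Order types of sets of ordinals. -/

theorem otp_le_of_strictMonoOn {A B : Set Ordinal.{u}} (f : Ordinal.{u} → Ordinal.{u})
    (hf : StrictMonoOn f A) (hAB : MapsTo f A B) : otp A ≤ otp B := by
  refine Ordinal.type_le_iff'.2 ⟨RelEmbedding.ofMonotone (fun x => ⟨f x, hAB x.2⟩) ?_⟩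
  intro x y h
  exact hf x.2 y.2 h

theorem otp_mono {A B : Set Ordinal.{u}} (h : A ⊆ B) : otp A ≤ otp B :=
  otp_le_of_strictMonoOn id (fun _ _ _ _ h => h) h

theorem otp_image {A : Set Ordinal.{u}} {f : Ordinal.{u} → Ordinal.{u}}
    (hf : StrictMonoOn f A) : otp (f '' A) = otp A := by
  refine (Ordinal.type_eq.2 ⟨RelIso.mk (Equiv.Set.imageOfInjOn f A hf.injOn) ?_⟩).symm
  intro x y
  exact hf.lt_iff_lt x.2 y.2

theorem otp_Iio (a : Ordinal.{u}) : otp (Iio a) = Ordinal.lift.{u + 1} a :=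
  Ordinal.type_lt_Iio a

theorem otp_inter_Iio_lt {A : Set Ordinal.{u}} {b : Ordinal.{u}} (hb : b ∈ A) :
    otp (A ∩ Iio b) < otp A := by
  refine lt_of_le_of_lt ?_ (Ordinal.typein_lt_type (fun x y : A => x < y) ⟨b, hb⟩)
  rw [← Ordinal.type_Iio_lt]
  exact Ordinal.type_le_iff'.2
    ⟨RelEmbedding.ofMonotone (fun x => ⟨⟨x, x.2.1⟩, x.2.2⟩) fun x y h => h⟩

theorem otp_inter_Iio_lt_iff {A : Set Ordinal.{u}} {b c : Ordinal.{u}} (hb : b ∈ A) (hc : c ∈ A) :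
    otp (A ∩ Iio b) < otp (A ∩ Iio c) ↔ b < c := by
  have key : ∀ {b c}, b ∈ A → b < c → otp (A ∩ Iio b) < otp (A ∩ Iio c) := by
    intro b c hb hbc
    have := otp_inter_Iio_lt (A := A ∩ Iio c) ⟨hb, hbc⟩
    rwa [inter_assoc, Iio_inter_Iio, min_eq_right hbc.le] at this
  refine ⟨fun h => ?_, key hb⟩
  by_contra! hcb
  rcases hcb.eq_or_lt with rfl | hcb
  · exact lt_irrefl _ h
  · exact lt_asymm h (key hc hcb)

/-! ### Closures below an ordinal. -/

theorem accPt_mono {x : Ordinal.{u}} {A B : Set Ordinal.{u}} (h : A ⊆ B)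
    (hx : AccPt x (𝓟 A)) : AccPt x (𝓟 B) :=
  hx.mono (Filter.principal_mono.2 h)

theorem accPt_inter_Iio {x β : Ordinal.{u}} {A : Set Ordinal.{u}} (h : x ≤ β) :
    AccPt x (𝓟 (A ∩ Iio β)) ↔ AccPt x (𝓟 A) := by
  refine ⟨accPt_mono inter_subset_left, fun hx => ?_⟩
  rw [accPt_iff] at hx ⊢
  refine ⟨hx.1, fun b hb => ?_⟩
  obtain ⟨y, hy, h1, h2⟩ := hx.2 b hb
  exact ⟨y, ⟨hy, h2.trans_le h⟩, h1, h2⟩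

/-- The closure of `D` in the ordinal `β`. -/
def clBelow (D : Set Ordinal.{u}) (β : Ordinal.{u}) : Set Ordinal.{u} :=
  {x | x < β ∧ (x ∈ D ∨ AccPt x (𝓟 D))}

theorem accPt_clBelow {D : Set Ordinal.{u}} {x β : Ordinal.{u}} (h : AccPt x (𝓟 (clBelow D β))) :
    AccPt x (𝓟 D) := by
  rw [accPt_iff] at h ⊢
  refine ⟨h.1, fun b hb => ?_⟩
  obtain ⟨y, ⟨_, hy⟩, h1, h2⟩ := h.2 b hb
  rcases hy with hy | hy
  · exact ⟨y, hy, h1, h2⟩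
  · obtain ⟨z, hz, h3, h4⟩ := (accPt_iff.1 hy).2 b h1
    exact ⟨z, hz, h3, h4.trans h2⟩

theorem clBelow_inter_Iio {D : Set Ordinal.{u}} {γ β : Ordinal.{u}} (h : γ ≤ β) :
    clBelow D β ∩ Iio γ = clBelow (D ∩ Iio γ) γ := by
  ext x
  constructor
  · rintro ⟨⟨_, hx⟩, hxγ⟩
    exact ⟨hxγ, hx.imp (fun h => ⟨h, hxγ⟩) (accPt_inter_Iio (le_of_lt hxγ)).2⟩
  · rintro ⟨hxγ, hx⟩
    exact ⟨⟨hxγ.trans_le h, hx.imp (fun h => h.1) (accPt_mono inter_subset_left)⟩, hxγ⟩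

/-- Closing off adds only accumulation points. Coherence of a closure therefore needs checking only
at points of the original set. -/
theorem nacc_clBelow {D : Set Ordinal.{u}} {β : Ordinal.{u}} : nacc (clBelow D β) ⊆ D := by
  rintro x ⟨⟨hxβ, hx⟩, hacc⟩
  refine hx.resolve_right fun h => hacc ?_
  exact accPt_mono (fun y hy => ⟨hy.2, Or.inl hy.1⟩) ((accPt_inter_Iio hxβ.le).2 h)

theorem isClubOf_clBelow {D : Set Ordinal.{u}} {β : Ordinal.{u}} (hD : D ⊆ Iio β)
    (h : ∀ a < β, ∃ b ∈ D, a ≤ b) : IsClubOf (clBelow D β) β := by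
  refine isClubOf_iff.2 ⟨fun x hx => hx.1, fun x hx hacc => ⟨hx, Or.inr (accPt_clBelow hacc)⟩, ?_⟩
  intro a ha
  obtain ⟨b, hb, hab⟩ := h a ha
  exact ⟨b, ⟨hD hb, Or.inl hb⟩, hab⟩

theorem clBelow_subset {D G : Set Ordinal.{u}} {β γ : Ordinal.{u}} (hG : IsClubOf G γ)
    (hβ : β ≤ γ) (h : D ⊆ G) : clBelow D β ⊆ G := by
  rintro x ⟨hxβ, hx | hx⟩
  · exact h hx
  · exact (isClubOf_iff.1 hG).2.1 x (hxβ.trans_le hβ) (accPt_mono h hx)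

/-- Sending a point of the closure to the next element of `D` strictly above it is strictly
increasing, because `D` meets (x, y] whenever x < y lie in the closure. -/
theorem otp_clBelow {D : Set Ordinal.{u}} {β : Ordinal.{u}} (hD : D ⊆ Iio β)
    (h : ∀ a < β, ∃ b ∈ D, a < b) : otp (clBelow D β) = otp D := by
  refine le_antisymm ?_ (otp_mono fun x hx => ⟨hD hx, Or.inl hx⟩)
  have hne : ∀ x < β, {d ∈ D | x < d}.Nonempty := fun x hx => h x hx
  refine otp_le_of_strictMonoOn (fun x => sInf {d ∈ D | x < d}) ?_ ?_
  · intro x hx y hy hxy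
    have hy' := csInf_mem (hne y hy.1)
    refine lt_of_le_of_lt ?_ hy'.2
    rcases hy.2 with hyD | hyD
    · exact csInf_le' ⟨hyD, hxy⟩
    · obtain ⟨z, hz, h1, h2⟩ := (accPt_iff.1 hyD).2 x hxy
      exact (csInf_le' (show z ∈ {d ∈ D | x < d} from ⟨hz, h1⟩)).trans h2.le
  · intro x hx
    exact (csInf_mem (hne x hx.1)).1

/-! ### Reduction to families without built-in coherence. -/

theorem cof_eq_of_isClubOf {C : Set Ordinal.{u}} {δ δs : Ordinal.{u}} (hC : IsClubOf C δ)
    (h : otp C = Ordinal.lift.{u + 1} δs) : δ.cof = δs.cof := by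
  have h1 : Order.cof (Subtype.val ⁻¹' C : Set (Iio δ)) = Order.cof (Iio δ) :=
    cof_eq_of_isCofinal hC.2.isCofinal
  have h2 : typeLT (Subtype.val ⁻¹' C : Set (Iio δ)) = otp C := by
    refine Ordinal.type_eq.2 ⟨RelIso.mk ⟨fun x => ⟨x.1, x.2⟩, fun x => ⟨⟨x, hC.1 x.2⟩, x.2⟩,
      fun _ => rfl, fun _ => rfl⟩ Iff.rfl⟩
  rw [← cof_type, h2, h, cof_Iio, ← lift_cof, ← lift_cof] at h1
  exact (Cardinal.lift_injective h1).symm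

/-- It suffices to find small families `R α` and a family `W` of size at most `lam` such that every
club of `lam` contains a member of `W` whose initial segments at non-accumulation points are in
the families `R β`. -/
theorem exists_guessingFamilies {lam : Cardinal.{u}} {δs : Ordinal.{u}}
    (hδs : Order.IsSuccLimit δs) (R : Ordinal.{u} → Set (Set Ordinal.{u}))
    (W : Set (Set Ordinal.{u}))
    (hR : ∀ α < lam.ord, #(R α) < Cardinal.lift.{u + 1} lam) (hW : #W ≤ Cardinal.lift.{u + 1} lam)
    (h : ∀ E, IsClubOf E lam.ord → ∃ C ∈ W, ∃ δ < lam.ord, C ⊆ E ∧ IsClubOf C δ ∧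
      otp C = Ordinal.lift.{u + 1} δs ∧ ∀ β ∈ nacc C, C ∩ Iio β ∈ R β) :
    ∃ (S : Set Ordinal.{u}) (P₁ P₂ : Ordinal.{u} → Set (Set Ordinal.{u})),
      IsStationaryIn S lam.ord ∧
      S ⊆ {δ | δ < lam.ord ∧ δ.cof = δs.cof} ∧
      GuessingFamilies lam δs S P₁ P₂ := by
  have hnacc : ∀ {C : Set Ordinal.{u}} {β γ}, γ ∈ nacc (C ∩ Iio β) →
      γ < β ∧ γ ∈ nacc C := fun {C β γ} hγ =>
    ⟨hγ.1.2, hγ.1.1, fun hacc => hγ.2 ((accPt_inter_Iio (le_of_lt hγ.1.2)).2 hacc)⟩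
  have hsub : ∀ {C : Set Ordinal.{u}} {β γ}, γ < β → C ∩ Iio β ∩ Iio γ = C ∩ Iio γ := by
    intro C β γ hγ
    rw [inter_assoc, Iio_inter_Iio, min_eq_right hγ.le]
  have hclosed : ∀ {C : Set Ordinal.{u}} {α β}, β < α →
      (∀ x < α, AccPt x (𝓟 C) → x ∈ C) → IsClosedSubset (C ∩ Iio β) β := by
    intro C α β hβ hC
    refine isClosedSubset_iff.2 ⟨inter_subset_right, fun x hx hacc => ⟨?_, hx⟩⟩
    exact hC x (hx.trans hβ) (accPt_mono inter_subset_left hacc)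
  have hguess : ∀ E, IsClubOf E lam.ord → ∃ C ∈ W, ∃ δ < lam.ord, δ ∈ E ∧ δ.cof = δs.cof ∧
      C ⊆ E ∧ IsClubOf C δ ∧ otp C = Ordinal.lift.{u + 1} δs ∧
      ∀ β ∈ nacc C, C ∩ Iio β ∈ R β := by
    intro E hE
    obtain ⟨C, hCW, δ, hδ, hCE, hCδ, hotp, hCR⟩ := h E hE
    have hcof := cof_eq_of_isClubOf hCδ hotp
    -- As δ is a limit, it is an accumulation point of `C ⊆ E`, hence belongs to `E`.
    have hlim : Order.IsSuccLimit δ := by rwa [← one_lt_cof_iff, hcof, one_lt_cof_iff]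
    refine ⟨C, hCW, δ, hδ, (isClubOf_iff.1 hE).2.1 δ hδ (accPt_mono hCE ?_), hcof, hCE, hCδ, hotp,
      hCR⟩
    refine accPt_iff.2 ⟨hlim.bot_lt.ne', fun b hb => ?_⟩
    obtain ⟨y, hy, hby⟩ := (isClubOf_iff.1 hCδ).2.2 _ (hlim.succ_lt hb)
    exact ⟨y, hy, Order.succ_le_iff.1 hby, hCδ.1 hy⟩
  -- Filtering `R` by a hereditary condition gives coherence: an initial segment of an initial
  -- segment of `C` is again one of `C`. Filtering only lowers the cardinalities.
  refine ⟨{δ | δ < lam.ord ∧ δ.cof = δs.cof},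
    fun α => {x ∈ R α | IsClosedSubset x α ∧ otp x < Ordinal.lift.{u + 1} δs ∧
      ∀ γ ∈ nacc x, x ∩ Iio γ ∈ R γ},
    fun δ => {C ∈ W | IsClubOf C δ ∧ otp C = Ordinal.lift.{u + 1} δs ∧
      ∀ β ∈ nacc C, C ∩ Iio β ∈ R β}, ⟨fun δ hδ => hδ.1, ?_⟩, subset_rfl, ?_⟩
  · intro t ht
    obtain ⟨C, -, δ, hδ, hδE, hcof, -⟩ := hguess (Subtype.val '' t)
      ⟨by rintro _ ⟨x, -, rfl⟩; exact x.2, by rwa [preimage_image_eq _ Subtype.val_injective]⟩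
    obtain ⟨x, hx, rfl⟩ := hδE
    exact ⟨x, ⟨hδ, hcof⟩, hx⟩
  · constructor
    · exact fun α hα => (mk_le_mk_of_subset (sep_subset _ _)).trans_lt (hR α hα)
    · exact fun α _ C hC => hC.2.1
    · exact fun α _ C hC => hC.2.2.1
    · rintro α _ C ⟨hCR, hCα, hotp, hC⟩ β hβ
      have hC' := isClosedSubset_iff.1 hCα
      refine ⟨hC β hβ, hclosed (hC'.1 hβ.1) hC'.2, (otp_mono inter_subset_left).trans_lt hotp, ?_⟩
      intro γ hγ
      rw [hsub (hnacc hγ).1]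
      exact hC γ (hnacc hγ).2
    · exact fun δ _ => (mk_le_mk_of_subset (sep_subset _ _)).trans hW
    · exact fun δ _ C hC => hC.2.1
    · exact fun δ _ C hC => hC.2.2.1
    · rintro α _ C ⟨hCW, hCα, hotp, hC⟩ β hβ
      have hC' := isClubOf_iff.1 hCα
      refine ⟨hC β hβ, hclosed (hC'.1 hβ.1) hC'.2.1, hotp ▸ otp_inter_Iio_lt hβ.1, ?_⟩
      intro γ hγ
      rw [hsub (hnacc hγ).1]
      exact hC γ (hnacc hγ).2
    · intro E hE
      obtain ⟨C, hCW, δ, hδ, hδE, hcof, hCE, hCδ, hotp, hCR⟩ := hguess E hE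
      exact ⟨δ, ⟨hδE, hδ, hcof⟩, hcof, C, ⟨hCW, hCδ, hotp, hCR⟩, hCE⟩

/-! ### Cardinality bounds, intersections of clubs, normal sequences in a club. -/

theorem exists_lt_ord_forall_lt {lam : Cardinal.{u}} (hreg : lam.ord.cof = lam)
    {A : Set Ordinal.{u}} (hA : #A < Cardinal.lift.{u + 1} lam) (hlt : ∀ x ∈ A, x < lam.ord) :
    ∃ b < lam.ord, ∀ x ∈ A, x < b := by
  refine ⟨sSup ((· + 1) '' A), sSup_add_one_lt_of_lt_cof ?_ hlt, fun x hx => ?_⟩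
  · rwa [← lift_cof, hreg]
  · refine (lt_add_one x).trans_le (le_csSup ⟨lam.ord, ?_⟩ (mem_image_of_mem _ hx))
    rintro _ ⟨y, hy, rfl⟩
    exact Order.add_one_le_of_lt (hlt y hy)

theorem mk_Iio_lt_lift {lam : Cardinal.{u}} {i : Ordinal.{u}} (hi : i < lam.ord) :
    #(Iio i) < Cardinal.lift.{u + 1} lam := by
  rw [Cardinal.mk_Iio_ordinal]
  exact Cardinal.lift_lt.2 (Cardinal.lt_ord.1 hi)

theorem mk_image2_lt {α β γ : Type (u + 1)} {lam : Cardinal.{u}} (hlam : ℵ₀ ≤ lam)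
    {f : α → β → γ} {s : Set α} {t : Set β} (hs : #s < Cardinal.lift.{u + 1} lam)
    (ht : #t < Cardinal.lift.{u + 1} lam) : #(image2 f s t) < Cardinal.lift.{u + 1} lam := by
  refine (mk_image_le (f := fun p : α × β => f p.1 p.2) (s := s ×ˢ t)) |> fun h => ?_
  rw [image_prod] at h
  refine h.trans_lt ?_
  rw [mk_setProd]
  exact mul_lt_of_lt (by simpa using hlam) hs ht

theorem mk_image2_le {α β γ : Type (u + 1)} {lam : Cardinal.{u}} (hlam : ℵ₀ ≤ lam)
    {f : α → β → γ} {s : Set α} {t : Set β} (hs : #s ≤ Cardinal.lift.{u + 1} lam)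
    (ht : #t ≤ Cardinal.lift.{u + 1} lam) : #(image2 f s t) ≤ Cardinal.lift.{u + 1} lam := by
  refine (mk_image_le (f := fun p : α × β => f p.1 p.2) (s := s ×ˢ t)) |> fun h => ?_
  rw [image_prod] at h
  refine h.trans ?_
  rw [mk_setProd]
  exact (mul_le_mul' hs ht).trans (mul_eq_self (by simpa using hlam)).le

theorem isClubOf_forall_lt {lam : Cardinal.{u}} (hreg : lam.ord.cof = lam) (hlam : ℵ₀ < lam)
    {F : Ordinal.{u} → Set Ordinal.{u}} {ζ : Ordinal.{u}} (hζ : ζ < lam.ord)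
    (hF : ∀ ξ < ζ, IsClubOf (F ξ) lam.ord) :
    IsClubOf {x | x < lam.ord ∧ ∀ ξ < ζ, x ∈ F ξ} lam.ord := by
  refine ⟨fun x hx => hx.1, ?_⟩
  have hcof : Order.cof (Iio lam.ord) = Cardinal.lift.{u + 1} lam := by
    rw [cof_Iio, ← lift_cof, hreg]
  have := IsClub.sInter (s := (fun ξ => (Subtype.val ⁻¹' F ξ : Set (Iio lam.ord))) '' Iio ζ)
    ?_ ?_ ?_
  · convert this using 1
    ext x
    suffices h : (x : Ordinal) < lam.ord by simp [h]
    exact x.2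
  · rw [hcof]
    exact (by simpa using hlam : ℵ₀ < Cardinal.lift.{u + 1} lam).ne'
  · rw [hcof]
    exact mk_image_le.trans_lt (mk_Iio_lt_lift hζ)
  · rintro _ ⟨ξ, hξ, rfl⟩
    exact (hF ξ hξ).2

/-- Each `a i` is the least point of `E` above everything required so far; regularity bounds the
requirements. In the transfer argument, `H` is the stage at which a set enters a family. -/
theorem exists_normal_sequence {lam : Cardinal.{u}} (hreg : lam.ord.cof = lam) (hlam : ℵ₀ < lam)
    {E : Set Ordinal.{u}} (hE : IsClubOf E lam.ord) (H : Set Ordinal.{u} → Ordinal.{u})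
    (hH : ∀ x, H x < lam.ord) (Q : Set (Set Ordinal.{u})) (hQ : #Q < Cardinal.lift.{u + 1} lam) :
    ∃ a : Ordinal.{u} → Ordinal.{u}, ∀ i < lam.ord, a i ∈ E ∧ 0 < a i ∧ (∀ k < i, a k < a i) ∧
      (∀ j < i, ∀ c ∈ Q, H (a '' (c ∩ Iio j)) < a i) ∧
      (Order.IsSuccLimit i → ∀ b < a i, ∃ k < i, b < a k) := by
  have hlim : Order.IsSuccLimit lam.ord := isSuccLimit_ord hlam.le
  let P : (Ordinal.{u} → Ordinal.{u}) → Ordinal.{u} → Set Ordinal.{u} := fun a i =>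
    {e | e ∈ E ∧ 0 < e ∧ (∀ k < i, a k < e) ∧ ∀ j < i, ∀ c ∈ Q, H (a '' (c ∩ Iio j)) < e}
  obtain ⟨a, ha⟩ : ∃ a : Ordinal.{u} → Ordinal.{u}, ∀ i, a i = sInf (P a i) := by
    let G : (i : Ordinal.{u}) → ((k : Ordinal.{u}) → k < i → Ordinal.{u}) → Ordinal.{u} :=
      -- The default 0 is harmless: `P a i` depends only on values of `a` below `i`.
      fun i r => sInf (P (fun k => if h : k < i then r k h else 0) i)
    refine ⟨WellFoundedLT.fix G, fun i => ?_⟩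
    rw [WellFoundedLT.fix_eq]
    refine congrArg sInf ?_
    ext e
    have himg : ∀ j < i, ∀ c : Set Ordinal.{u},
        (fun k => if h : k < i then WellFoundedLT.fix G k else 0) '' (c ∩ Iio j) =
          WellFoundedLT.fix G '' (c ∩ Iio j) := by
      intro j hj c
      refine image_congr fun k hk => ?_
      exact dif_pos (lt_trans hk.2 hj)
    refine and_congr_right fun _ => and_congr_right fun _ => and_congr ?_ ?_
    · refine forall₂_congr fun k hk => ?_
      simp [hk]
    · refine forall₂_congr fun j hj => forall₂_congr fun c _ => ?_
      rw [himg j hj c]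
  have hE' := isClubOf_iff.1 hE
  have hne : ∀ i < lam.ord, (P a i).Nonempty := by
    intro i
    induction i using WellFoundedLT.induction with
    | ind i ih =>
    intro hi
    obtain ⟨b, hb, hab⟩ := exists_lt_ord_forall_lt hreg (A := a '' Iio i)
      (mk_image_le.trans_lt (mk_Iio_lt_lift hi)) (by
        rintro _ ⟨k, hk, rfl⟩
        have := csInf_mem (ih k hk (lt_trans hk hi))
        rw [← ha k] at this
        exact hE'.1 this.1)
    obtain ⟨b', hb', hab'⟩ := exists_lt_ord_forall_lt hreg
      (A := image2 (fun j c => H (a '' (c ∩ Iio j))) (Iio i) Q)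
      (mk_image2_lt hlam.le (mk_Iio_lt_lift hi) hQ) (by
        rintro _ ⟨k, hk, c, hc, rfl⟩
        exact hH _)
    obtain ⟨e, he, hbe⟩ := hE'.2.2 (max (max b b') 1)
      (max_lt (max_lt hb hb') (by simpa using hlim.succ_lt hlim.bot_lt))
    refine ⟨e, he, (zero_lt_one).trans_le ((le_max_right _ _).trans hbe), fun k hk => ?_,
      fun j hj c hc => ?_⟩
    · exact (hab _ ⟨k, hk, rfl⟩).trans_le (((le_max_left _ _).trans (le_max_left _ _)).trans hbe)
    · exact (hab' _ ⟨j, hj, c, hc, rfl⟩).trans_le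
        (((le_max_right _ _).trans (le_max_left _ _)).trans hbe)
  have hmem : ∀ i < lam.ord, a i ∈ P a i := fun i hi => by
    have := csInf_mem (hne i hi)
    rwa [← ha i] at this
  refine ⟨a, fun i hi => ⟨(hmem i hi).1, (hmem i hi).2.1, (hmem i hi).2.2.1, (hmem i hi).2.2.2,
    fun hil b hb => ?_⟩⟩
  -- At a limit, the supremum of the earlier values is itself a candidate, since each requirement
  -- indexed by `j < i` was already met at stage `j + 1`. So the least candidate is at most that
  -- supremum.
  by_contra! hcon
  have hbdd : BddAbove (a '' Iio i) := ⟨b, by rintro _ ⟨k, hk, rfl⟩; exact hcon k hk⟩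
  have hlt : ∀ k < i, a k < sSup (a '' Iio i) := fun k hk =>
    ((hmem _ ((hil.succ_lt hk).trans hi)).2.2.1 k (Order.lt_succ k)).trans_le
      (le_csSup hbdd ⟨_, hil.succ_lt hk, rfl⟩)
  have hsb : sSup (a '' Iio i) ≤ b := csSup_le' (by rintro _ ⟨k, hk, rfl⟩; exact hcon k hk)
  refine absurd ((ha i).trans_le (csInf_le' (show sSup (a '' Iio i) ∈ P a i from ?_)))
    (not_le.2 (hsb.trans_lt hb))
  refine ⟨?_, pos_of_gt (hlt 0 hil.bot_lt), hlt, fun j hj c hc => ?_⟩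
  · refine hE'.2.1 _ ((hsb.trans_lt hb).trans (hE'.1 (hmem i hi).1)) (accPt_iff.2
      ⟨(pos_of_gt (hlt 0 hil.bot_lt)).ne', fun d hd => ?_⟩)
    obtain ⟨_, ⟨k, hk, rfl⟩, hdk⟩ := exists_lt_of_lt_csSup' hd
    exact ⟨a k, (hmem k (lt_trans hk hi)).1, hdk, hlt k hk⟩
  · exact ((hmem _ ((hil.succ_lt hj).trans hi)).2.2.2 j (Order.lt_succ j) c hc).trans_le
      (le_csSup hbdd ⟨_, hil.succ_lt hj, rfl⟩)

/-! ### Closing off in ω steps, and normal enumerations. -/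

theorem exists_closure_point {τ : Cardinal.{u}} (hreg : τ.ord.cof = τ) (hτ : ℵ₀ < τ)
    {r : Ordinal.{u} → Ordinal.{u} → Prop}
    (h : ∀ i < τ.ord, ∃ j < τ.ord, i < j ∧ r i j) {i₀ : Ordinal.{u}} (hi₀ : i₀ < τ.ord) :
    ∃ s : ℕ → Ordinal.{u}, s 0 = i₀ ∧ (∀ n, s n < τ.ord ∧ s n < s (n + 1) ∧ r (s n) (s (n + 1))) ∧
      ∃ i < τ.ord, (∀ n, s n < i) ∧ ∀ k < i, ∃ n, k < s n := by
  choose! g hg using h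
  let s : ℕ → Ordinal.{u} := fun n => g^[n] i₀
  have hs : ∀ n, s (n + 1) = g (s n) := fun n => Function.iterate_succ_apply' g n i₀
  have hlt : ∀ n, s n < τ.ord := by
    intro n
    induction n with
    | zero => exact hi₀
    | succ n ih => exact hs n ▸ (hg _ ih).1
  have hsucc : ∀ n, s n < s (n + 1) := fun n => hs n ▸ (hg _ (hlt n)).2.1
  refine ⟨s, rfl, fun n => ⟨hlt n, hsucc n, hs n ▸ (hg _ (hlt n)).2.2⟩, ⨆ n, s n, ?_, ?_, ?_⟩
  · refine Ordinal.lift_iSup_lt_of_lt_cof ?_ hlt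
    simpa [hreg] using hτ
  · exact fun n => (hsucc n).trans_le (Ordinal.le_iSup s (n + 1))
  · exact fun k hk => Ordinal.lt_iSup_iff.1 hk

/-- `e` enumerates, increasingly and continuously on the ordinals below `τ`, a cofinal subset
of `δ`. -/
structure IsNormalBelow (e : Ordinal.{u} → Ordinal.{u}) (τ δ : Ordinal.{u}) : Prop where
  strictMono : ∀ i < τ, ∀ k < i, e k < e i
  continuous : ∀ i < τ, Order.IsSuccLimit i → ∀ b < e i, ∃ k < i, b < e k
  lt : ∀ i < τ, e i < δ
  cofinal : ∀ b < δ, ∃ i < τ, b < e i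

namespace IsNormalBelow

variable {e a : Ordinal.{u} → Ordinal.{u}} {τ δ : Ordinal.{u}}

theorem strictMonoOn (h : IsNormalBelow e τ δ) : StrictMonoOn e (Iio τ) :=
  fun _ _ j hj hij => h.strictMono j hj _ hij

theorem mono (h : IsNormalBelow e τ δ) {i : Ordinal.{u}} (hi : i < τ)
    (hlim : Order.IsSuccLimit i) : IsNormalBelow e i (e i) where
  strictMono j hj := h.strictMono j (hj.trans hi)
  continuous j hj := h.continuous j (hj.trans hi)
  lt := h.strictMono i hi
  cofinal := h.continuous i hi hlim

theorem isClubOf_image (h : IsNormalBelow e τ δ) {c : Set Ordinal.{u}} (hc : IsClubOf c τ) :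
    IsClubOf (e '' c) δ := by
  obtain ⟨hcτ, hclosed, hcof⟩ := isClubOf_iff.1 hc
  refine isClubOf_iff.2 ⟨?_, fun x hx hacc => ?_, fun b hb => ?_⟩
  · rintro _ ⟨j, hj, rfl⟩
    exact h.lt j (hcτ hj)
  · obtain ⟨k, hk, hxk⟩ := h.cofinal x hx
    have hne : {j | x ≤ e j}.Nonempty := ⟨k, hxk.le⟩
    -- An accumulation point of the image must be the value at this index: `j` accumulates `c`, and
    -- continuity at `j` rules out `x < e j`.
    set j := sInf {j | x ≤ e j} with hj
    have hxj : x ≤ e j := csInf_mem hne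
    have hjk : j ≤ k := csInf_le' hxk.le
    have hjτ : j < τ := hjk.trans_lt hk
    have hlt : ∀ b < j, e b < x := fun b hb => not_le.1 fun hle => not_le.2 hb (csInf_le' hle)
    have hacc' := accPt_iff.1 hacc
    have hback : ∀ y ∈ c, e y < x → y < j := fun y hy hyx =>
      (h.strictMonoOn.lt_iff_lt (hcτ hy) hjτ).1 (hyx.trans_le hxj)
    have hjacc : AccPt j (𝓟 c) := by
      refine accPt_iff.2 ⟨?_, fun b hb => ?_⟩
      · obtain ⟨_, ⟨y, hy, rfl⟩, -, hyx⟩ := hacc'.2 0 (pos_iff_ne_zero.2 hacc'.1)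
        exact (pos_of_gt (hback y hy hyx)).ne'
      · obtain ⟨_, ⟨y, hy, rfl⟩, hby, hyx⟩ := hacc'.2 _ (hlt b hb)
        exact ⟨y, hy, (h.strictMonoOn.lt_iff_lt (hb.trans hjτ) (hcτ hy)).1 hby, hback y hy hyx⟩
    refine ⟨j, hclosed j hjτ hjacc, hxj.antisymm' ?_⟩
    by_contra! hlt'
    obtain ⟨m, hm, hxm⟩ := h.continuous j hjτ hjacc.isSuccLimit x hlt'
    exact lt_asymm hxm (hlt m hm)
  · obtain ⟨k, hk, hbk⟩ := h.cofinal b hb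
    obtain ⟨y, hy, hky⟩ := hcof k hk
    exact ⟨e y, ⟨y, hy, rfl⟩, hbk.le.trans ((h.strictMonoOn.le_iff_le hk (hcτ hy)).2 hky)⟩

theorem accPt_image (h : IsNormalBelow e τ δ) {c : Set Ordinal.{u}} {j : Ordinal.{u}} (hj : j < τ)
    (hacc : AccPt j (𝓟 c)) : AccPt (e j) (𝓟 (e '' c)) := by
  have hacc' := accPt_iff.1 hacc
  refine accPt_iff.2 ⟨?_, fun b hb => ?_⟩
  · exact (pos_of_gt (h.strictMono j hj 0 (pos_iff_ne_zero.2 hacc'.1))).ne'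
  · obtain ⟨k, hk, hbk⟩ := h.continuous j hj hacc.isSuccLimit b hb
    obtain ⟨y, hy, hky, hyj⟩ := hacc'.2 k hk
    exact ⟨e y, ⟨y, hy, rfl⟩, hbk.trans (h.strictMono y (hyj.trans hj) k hky),
      h.strictMono j hj y hyj⟩

/-- Two normal enumerations cofinal in the same ordinal interleave, so they agree at every limit
index closed under the interleaving. -/
theorem isClubOf_eq {τ : Cardinal.{u}} (hreg : τ.ord.cof = τ) (hτ : ℵ₀ < τ)
    (he : IsNormalBelow e τ.ord δ) (ha : IsNormalBelow a τ.ord δ) :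
    IsClubOf {i | i < τ.ord ∧ Order.IsSuccLimit i ∧ e i = a i} τ.ord := by
  have hle : ∀ {e a : Ordinal.{u} → Ordinal.{u}}, IsNormalBelow e τ.ord δ →
      IsNormalBelow a τ.ord δ → ∀ i < τ.ord, Order.IsSuccLimit i →
      (∀ k < i, ∃ m < i, e k < a m) → e i ≤ a i := by
    intro e a he ha i hi hlim h
    by_contra! hlt
    obtain ⟨k, hk, hk'⟩ := he.continuous i hi hlim _ hlt
    obtain ⟨m, hm, hkm⟩ := h k hk
    exact lt_asymm (hk'.trans hkm) (ha.strictMono i hi m hm)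
  refine isClubOf_iff.2 ⟨fun i hi => hi.1, fun x hx hacc => ?_, fun i₀ hi₀ => ?_⟩
  · have hacc' := accPt_iff.1 hacc
    refine ⟨hx, hacc.isSuccLimit, le_antisymm (hle he ha x hx hacc.isSuccLimit ?_)
      (hle ha he x hx hacc.isSuccLimit ?_)⟩
    · intro k hk
      obtain ⟨y, ⟨-, -, hy⟩, hky, hyx⟩ := hacc'.2 k hk
      exact ⟨y, hyx, hy ▸ he.strictMono y (hyx.trans hx) k hky⟩
    · intro k hk
      obtain ⟨y, ⟨-, -, hy⟩, hky, hyx⟩ := hacc'.2 k hk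
      exact ⟨y, hyx, hy ▸ ha.strictMono y (hyx.trans hx) k hky⟩
  · obtain ⟨s, hs0, hs, i, hi, hsi, his⟩ := exists_closure_point hreg hτ
      (r := fun i j => e i < a j ∧ a i < e j) (by
        intro i hi
        obtain ⟨j, hj, hij⟩ := ha.cofinal _ (he.lt i hi)
        obtain ⟨k, hk, hik⟩ := he.cofinal _ (ha.lt i hi)
        have hm : max (max j k) i < τ.ord := max_lt (max_lt hj hk) hi
        refine ⟨Order.succ (max (max j k) i), (isSuccLimit_ord hτ.le).succ_lt hm,
          Order.lt_succ_of_le (le_max_right _ _), ?_, ?_⟩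
        · exact hij.trans (ha.strictMono _ ((isSuccLimit_ord hτ.le).succ_lt hm) _
            (Order.lt_succ_of_le ((le_max_left _ _).trans (le_max_left _ _))))
        · exact hik.trans (he.strictMono _ ((isSuccLimit_ord hτ.le).succ_lt hm) _
            (Order.lt_succ_of_le ((le_max_right _ _).trans (le_max_left _ _))))) hi₀
    have hlim : Order.IsSuccLimit i := by
      refine (accPt_iff (s := range s)).2 ⟨(pos_of_gt (hsi 0)).ne', fun b hb => ?_⟩ |>.isSuccLimit
      obtain ⟨n, hn⟩ := his b hb
      exact ⟨s n, ⟨n, rfl⟩, hn, hsi n⟩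
    refine ⟨i, ⟨hi, hlim, le_antisymm (hle he ha i hi hlim ?_) (hle ha he i hi hlim ?_)⟩,
      hs0 ▸ (hsi 0).le⟩
    · intro k hk
      obtain ⟨n, hn⟩ := his k hk
      exact ⟨s (n + 1), hsi _, (he.strictMono _ (hs n).1 k hn).trans (hs n).2.2.1⟩
    · intro k hk
      obtain ⟨n, hn⟩ := his k hk
      exact ⟨s (n + 1), hsi _, (ha.strictMono _ (hs n).1 k hn).trans (hs n).2.2.2⟩

end IsNormalBelow

/-! ### Transfer from τ to a larger regular cardinal. -/

/-- Club guessing on a smaller regular uncountable cardinal `τ` transfers to `lam`, with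
coherence. -/
theorem exists_guessingFamilies_of_guessing {lam τ : Cardinal.{u}} {δs : Ordinal.{u}}
    (hδs : Order.IsSuccLimit δs) (hreg : lam.ord.cof = lam) (hτreg : τ.ord.cof = τ) (hτ : ℵ₀ < τ)
    (hτlam : τ < lam) (Q : Set (Set Ordinal.{u})) (hQ : #Q < Cardinal.lift.{u + 1} lam)
    (hguess : ∀ F, IsClubOf F τ.ord → ∃ c ∈ Q, ∃ i < τ.ord, c ⊆ F ∧ IsClubOf c i ∧
      otp c = Ordinal.lift.{u + 1} δs) :
    ∃ (S : Set Ordinal.{u}) (P₁ P₂ : Ordinal.{u} → Set (Set Ordinal.{u})),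
      IsStationaryIn S lam.ord ∧
      S ⊆ {δ | δ < lam.ord ∧ δ.cof = δs.cof} ∧
      GuessingFamilies lam δs S P₁ P₂ := by
  have hlam : ℵ₀ < lam := hτ.trans hτlam
  have hlim : Order.IsSuccLimit lam.ord := isSuccLimit_ord hlam.le
  have hτord : τ.ord < lam.ord := ord_lt_ord.2 hτlam
  have hex : ∀ δ : Ordinal.{u}, ∃ e : Ordinal.{u} → Ordinal.{u},
      (∃ a, IsNormalBelow a τ.ord δ) → IsNormalBelow e τ.ord δ := by
    intro δ
    by_cases h : ∃ a, IsNormalBelow a τ.ord δ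
    · exact ⟨h.choose, fun _ => h.choose_spec⟩
    · exact ⟨id, fun h' => absurd h' h⟩
  -- The enumerations are fixed before any club of `lam` is given, so `R` and `W` do not depend on
  -- the club.
  choose e he using hex
  let R : Ordinal.{u} → Set (Set Ordinal.{u}) := fun β =>
    image2 (fun δ x => e δ '' x) (Iio (Order.succ β)) (image2 (fun c j => c ∩ Iio j) Q (Iio τ.ord))
  have hRmono : ∀ {β γ}, β ≤ γ → R β ⊆ R γ := fun h =>
    image2_subset_right (Iio_subset_Iio (Order.succ_le_succ h))
  -- The first stage at which `x` enters `R`, or 0 if it never does.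
  let H : Set Ordinal.{u} → Ordinal.{u} := fun x => sInf {β | β < lam.ord ∧ x ∈ R β}
  have hH : ∀ x, H x < lam.ord := by
    intro x
    by_cases hne : {β | β < lam.ord ∧ x ∈ R β}.Nonempty
    · exact (csInf_mem hne).1
    · simp only [H, not_nonempty_iff_eq_empty.1 hne, Ordinal.sInf_empty]
      exact hlim.bot_lt
  refine exists_guessingFamilies hδs R (image2 (fun δ c => e δ '' c) (Iio lam.ord) Q)
    (fun α hα => ?_) ?_ fun E hE => ?_
  · exact mk_image2_lt hlam.le (mk_Iio_lt_lift (hlim.succ_lt hα))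
      (mk_image2_lt hlam.le hQ (mk_Iio_lt_lift hτord))
  · refine mk_image2_le hlam.le ?_ hQ.le
    rw [Cardinal.mk_Iio_ordinal, card_ord]
  · obtain ⟨a, ha⟩ := exists_normal_sequence hreg hlam hE H hH Q hQ
    have hbdd : BddAbove (a '' Iio τ.ord) := by
      refine ⟨a τ.ord, ?_⟩
      rintro _ ⟨k, hk, rfl⟩
      exact ((ha _ hτord).2.2.1 k hk).le
    obtain ⟨δ, hδ⟩ : ∃ δ, δ = a τ.ord := ⟨_, rfl⟩
    have hδlam : δ < lam.ord := hδ ▸ hE.1 (ha _ hτord).1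
    have haδ : IsNormalBelow a τ.ord δ :=
      { strictMono := fun i hi => (ha i (hi.trans hτord)).2.2.1
        continuous := fun i hi => (ha i (hi.trans hτord)).2.2.2.2
        lt := fun i hi => hδ ▸ (ha _ hτord).2.2.1 i hi
        cofinal := fun b hb => (ha _ hτord).2.2.2.2 (isSuccLimit_ord hτ.le) b (hδ ▸ hb) }
    have heδ := he δ ⟨a, haδ⟩
    obtain ⟨c, hcQ, i, hi, hcF, hci, hotp⟩ :=
      hguess _ (IsNormalBelow.isClubOf_eq hτreg hτ heδ haδ)
    have hilim : Order.IsSuccLimit i := by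
      rwa [← one_lt_cof_iff, cof_eq_of_isClubOf hci hotp, one_lt_cof_iff]
    have himg : ∀ x ⊆ c, e δ '' x = a '' x := fun x hx =>
      image_congr fun j hj => (hcF (hx hj)).2.2
    have hmono : StrictMonoOn a c := haδ.strictMonoOn.mono fun j hj => (hcF hj).1
    refine ⟨e δ '' c, ⟨δ, hδlam, c, hcQ, rfl⟩, a i, hE.1 (ha i (hi.trans hτord)).1, ?_⟩
    rw [himg c subset_rfl]
    refine ⟨?_, (haδ.mono hi hilim).isClubOf_image hci, (otp_image hmono).trans hotp, ?_⟩
    · rintro _ ⟨j, hj, rfl⟩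
      exact (ha j ((hcF hj).1.trans hτord)).1
    · rintro _ ⟨⟨j, hj, rfl⟩, hacc⟩
      obtain ⟨hjτ, hjlim, -⟩ := hcF hj
      have hjacc : ¬ AccPt j (𝓟 c) := fun h => hacc (haδ.accPt_image hjτ h)
      rw [accPt_iff] at hjacc
      push Not at hjacc
      obtain ⟨k, hk, hkj⟩ := hjacc hjlim.bot_lt.ne'
      -- Since `j` is a limit, the initial segment is already determined at `succ k < j`, so its
      -- stage `H` was taken into account before `a j` was chosen.
      have hc : c ∩ Iio j = c ∩ Iio (Order.succ k) := by
        ext y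
        refine and_congr_right fun hy => ⟨fun hyj => ?_, fun hyk => ?_⟩
        · by_contra! hlt
          exact absurd hyj (not_lt.2 (hkj y hy (Order.succ_le_iff.1 (not_lt.1 hlt))))
        · exact lt_trans hyk (hjlim.succ_lt hk)
      have himg' : a '' c ∩ Iio (a j) = a '' (c ∩ Iio j) := by
        ext x
        constructor
        · rintro ⟨⟨y, hy, rfl⟩, hyj⟩
          exact ⟨y, ⟨hy, (hmono.lt_iff_lt hy hj).1 hyj⟩, rfl⟩
        · rintro ⟨y, ⟨hy, hyj⟩, rfl⟩
          exact ⟨⟨y, hy, rfl⟩, (hmono.lt_iff_lt hy hj).2 hyj⟩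
      have hmem : a '' (c ∩ Iio (Order.succ k)) ∈ R δ := by
        rw [← himg _ inter_subset_left]
        exact ⟨δ, Order.lt_succ δ, _, ⟨c, hcQ, _, (hjlim.succ_lt hk).trans hjτ, rfl⟩, rfl⟩
      rw [himg', hc]
      exact hRmono ((ha j (hjτ.trans hτord)).2.2.2.1 _ (hjlim.succ_lt hk) c hcQ).le
        (csInf_mem (⟨δ, hδlam, hmem⟩ : {β | β < lam.ord ∧ _ ∈ R β}.Nonempty)).2

/-! ### Last points of a club, and selection by position. -/

/-- The last point of `E` that is at most `α`, for closed `E`. -/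
noncomputable def lastPoint (E : Set Ordinal.{u}) (α : Ordinal.{u}) : Ordinal.{u} :=
  sSup (E ∩ Iic α)

theorem lastPoint_le (E : Set Ordinal.{u}) (α : Ordinal.{u}) : lastPoint E α ≤ α :=
  csSup_le' fun _ hx => hx.2

theorem le_lastPoint {E : Set Ordinal.{u}} {α x : Ordinal.{u}} (hx : x ∈ E) (h : x ≤ α) :
    x ≤ lastPoint E α :=
  le_csSup ⟨α, fun _ hx => hx.2⟩ ⟨hx, h⟩

theorem lastPoint_eq_self {E : Set Ordinal.{u}} {α : Ordinal.{u}} (h : α ∈ E) :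
    lastPoint E α = α :=
  (lastPoint_le E α).antisymm (le_lastPoint h le_rfl)

theorem lastPoint_mono {E F : Set Ordinal.{u}} (h : E ⊆ F) (α : Ordinal.{u}) :
    lastPoint E α ≤ lastPoint F α :=
  csSup_le' fun _ hx => le_lastPoint (h hx.1) hx.2

theorem lastPoint_mem {E : Set Ordinal.{u}} {α γ : Ordinal.{u}} (hE : IsClubOf E γ) (hα : α < γ)
    (h0 : lastPoint E α ≠ 0) : lastPoint E α ∈ E := by
  by_contra hcon
  refine hcon ((isClubOf_iff.1 hE).2.1 _ ((lastPoint_le E α).trans_lt hα)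
    (accPt_iff.2 ⟨h0, fun b hb => ?_⟩))
  obtain ⟨y, hy, hby⟩ := exists_lt_of_lt_csSup' hb
  exact ⟨y, hy.1, hby, (le_lastPoint hy.1 hy.2).lt_of_ne fun h => hcon (h ▸ hy.1)⟩

/-- The nonzero last points of `E` below the elements of `A`. -/
noncomputable def lastPoints (E A : Set Ordinal.{u}) : Set Ordinal.{u} :=
  lastPoint E '' A \ {0}

/-- The elements of `B` whose position in the increasing enumeration of `B` is in `T`. -/
def select (B : Set Ordinal.{u}) (T : Set Ordinal.{u + 1}) : Set Ordinal.{u} :=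
  {β ∈ B | otp (B ∩ Iio β) ∈ T}

/-- The position of a point depends only on what lies below it, so one `T` serves `B` and all its
initial segments. -/
theorem select_inter_Iio (B : Set Ordinal.{u}) (T : Set Ordinal.{u + 1}) (β : Ordinal.{u}) :
    select B T ∩ Iio β = select (B ∩ Iio β) T := by
  ext x
  have h : x < β → B ∩ Iio β ∩ Iio x = B ∩ Iio x := fun h => by
    rw [inter_assoc, Iio_inter_Iio, min_eq_right h.le]
  constructor
  · rintro ⟨⟨h1, h2⟩, h3⟩
    exact ⟨⟨h1, h3⟩, (h h3).symm ▸ h2⟩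
  · rintro ⟨⟨h1, h3⟩, h2⟩
    exact ⟨⟨h1, (h h3) ▸ h2⟩, h3⟩

theorem exists_strictMonoOn_image_eq {A B : Set Ordinal.{u}} (h : otp A = otp B) :
    ∃ f : Ordinal.{u} → Ordinal.{u}, StrictMonoOn f A ∧ f '' A = B := by
  obtain ⟨φ⟩ := Ordinal.type_eq.1 h
  classical
  have hf : ∀ x (hx : x ∈ A),
      (if h : x ∈ A then (φ ⟨x, h⟩ : Ordinal.{u}) else 0) = φ ⟨x, hx⟩ := fun x hx => dif_pos hx
  refine ⟨fun x => if h : x ∈ A then φ ⟨x, h⟩ else 0, fun x hx y hy hxy => ?_, ?_⟩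
  · simp only [hf x hx, hf y hy]
    exact φ.map_rel_iff.2 (show (⟨x, hx⟩ : A) < ⟨y, hy⟩ from hxy)
  · ext y
    constructor
    · rintro ⟨x, hx, rfl⟩
      simp only [hf x hx]
      exact (φ ⟨x, hx⟩).2
    · intro hy
      refine ⟨φ.symm ⟨y, hy⟩, (φ.symm ⟨y, hy⟩).2, ?_⟩
      simp only [hf _ (φ.symm ⟨y, hy⟩).2]
      simp

theorem select_image {B C B' : Set Ordinal.{u}} (hC : C ⊆ B) {f : Ordinal.{u} → Ordinal.{u}}
    (hf : StrictMonoOn f B) (hB' : f '' B = B') :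
    select B' ((fun x => otp (B ∩ Iio x)) '' C) = f '' C := by
  subst hB'
  have himg : ∀ x ∈ B, otp (f '' B ∩ Iio (f x)) = otp (B ∩ Iio x) := by
    intro x hx
    rw [← otp_image (hf.mono (inter_subset_left (t := Iio x)))]
    congr 1
    ext y
    constructor
    · rintro ⟨⟨z, hz, rfl⟩, hzx⟩
      exact ⟨z, ⟨hz, (hf.lt_iff_lt hz hx).1 hzx⟩, rfl⟩
    · rintro ⟨z, ⟨hz, hzx⟩, rfl⟩
      exact ⟨⟨z, hz, rfl⟩, hf hz hx hzx⟩
  ext y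
  constructor
  · rintro ⟨⟨x, hx, rfl⟩, c, hc, hcx⟩
    simp only [himg x hx] at hcx
    have h1 := mt (otp_inter_Iio_lt_iff (hC hc) hx).2 hcx.not_lt
    have h2 := mt (otp_inter_Iio_lt_iff hx (hC hc)).2 hcx.not_gt
    exact ⟨c, hc, by rw [le_antisymm (not_lt.1 h2) (not_lt.1 h1)]⟩
  · rintro ⟨c, hc, rfl⟩
    exact ⟨⟨c, hC hc, rfl⟩, c, hc, (himg c (hC hc)).symm⟩

/-- Whether a set of positions works depends only on the order type of `B`: take the positions from
one witnessing pair and carry them along the order isomorphism. The selected set is thus coded by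
`η` instead of by an arbitrary subset of `B`, which keeps the families small. -/
theorem exists_selector (δs : Ordinal.{u + 1}) :
    ∃ T : Ordinal.{u} → Set Ordinal.{u + 1}, ∀ (η : Ordinal.{u}) (B C : Set Ordinal.{u}),
      otp B = Ordinal.lift.{u + 1} η → C ⊆ B → otp C = δs → (∀ b ∈ B, ∃ c ∈ C, b < c) →
      otp (select B (T η)) = δs ∧ ∀ b ∈ B, ∃ c ∈ select B (T η), b < c := by
  have key : ∀ η : Ordinal.{u}, ∃ T : Set Ordinal.{u + 1}, ∀ B C : Set Ordinal.{u},
      otp B = Ordinal.lift.{u + 1} η → C ⊆ B → otp C = δs → (∀ b ∈ B, ∃ c ∈ C, b < c) →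
      otp (select B T) = δs ∧ ∀ b ∈ B, ∃ c ∈ select B T, b < c := by
    intro η
    by_cases h : ∃ B C : Set Ordinal.{u}, otp B = Ordinal.lift.{u + 1} η ∧ C ⊆ B ∧ otp C = δs ∧
      ∀ b ∈ B, ∃ c ∈ C, b < c
    · obtain ⟨B, C, hB, hCB, hC, hcof⟩ := h
      refine ⟨(fun x => otp (B ∩ Iio x)) '' C, fun B' C' hB' _ _ _ => ?_⟩
      obtain ⟨f, hf, rfl⟩ := exists_strictMonoOn_image_eq (hB.trans hB'.symm)
      rw [select_image hCB hf rfl]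
      refine ⟨(otp_image (hf.mono hCB)).trans hC, ?_⟩
      rintro _ ⟨b, hb, rfl⟩
      obtain ⟨c, hc, hbc⟩ := hcof b hb
      exact ⟨f c, ⟨c, hc, rfl⟩, hf hb (hCB hc) hbc⟩
    · exact ⟨∅, fun B C h1 h2 h3 h4 => absurd ⟨B, C, h1, h2, h3, h4⟩ h⟩
  choose T hT using key
  exact ⟨T, hT⟩

/-! ### Stabilization and coherent approximations. -/

theorem exists_forall_of_eventually {μ : Cardinal.{u}} (hreg : μ.ord.cof = μ)
    {A : Set Ordinal.{u}} (hA : #A < Cardinal.lift.{u + 1} μ)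
    {p : Ordinal.{u} → Ordinal.{u} → Prop}
    (h : ∀ x ∈ A, ∃ i < μ.ord, ∀ j < μ.ord, i ≤ j → p x j) :
    ∃ i < μ.ord, ∀ j < μ.ord, i ≤ j → ∀ x ∈ A, p x j := by
  choose! g hg using h
  obtain ⟨i, hi, hgi⟩ := exists_lt_ord_forall_lt hreg (A := g '' A) (mk_image_le.trans_lt hA) (by
    rintro _ ⟨x, hx, rfl⟩
    exact (hg x hx).1)
  exact ⟨i, hi, fun j hj hij x hx => (hg x hx).2 j hj ((hgi _ ⟨x, hx, rfl⟩).le.trans hij)⟩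

theorem exists_Iio_subset_image {μ : Cardinal.{u}} {β : Ordinal.{u}} (h : β.card ≤ μ) :
    ∃ f : Ordinal.{u} → Ordinal.{u}, Iio β ⊆ f '' Iio μ.ord := by
  have hle : #(Iio β) ≤ #(Iio μ.ord) := by
    rw [Cardinal.mk_Iio_ordinal, Cardinal.mk_Iio_ordinal, card_ord]
    exact Cardinal.lift_le.2 h
  obtain ⟨g⟩ := Cardinal.le_def _ _ |>.1 hle
  have hinj : Function.Injective (fun x : Iio β => (g x : Ordinal.{u})) :=
    Subtype.val_injective.comp g.injective
  refine ⟨Function.extend (fun x : Iio β => (g x : Ordinal.{u})) Subtype.val 0, fun x hx => ?_⟩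
  exact ⟨g ⟨x, hx⟩, (g ⟨x, hx⟩).2, hinj.extend_apply _ _ ⟨x, hx⟩⟩

theorem exists_decreasing_clubs {lam : Cardinal.{u}} (hreg : lam.ord.cof = lam) (hlam : ℵ₀ < lam)
    {G : Set Ordinal.{u} → Set Ordinal.{u}}
    (hG : ∀ E, IsClubOf E lam.ord → IsClubOf (G E) lam.ord) :
    ∃ F : Ordinal.{u} → Set Ordinal.{u}, (∀ ζ < lam.ord, IsClubOf (F ζ) lam.ord) ∧
      ∀ ζ, F ζ = {x | x < lam.ord ∧ ∀ ξ < ζ, x ∈ G (F ξ)} := by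
  let K : (ζ : Ordinal.{u}) → ((ξ : Ordinal.{u}) → ξ < ζ → Set Ordinal.{u}) → Set Ordinal.{u} :=
    fun ζ r => {x | x < lam.ord ∧ ∀ ξ (h : ξ < ζ), x ∈ G (r ξ h)}
  have hF : ∀ ζ, WellFoundedLT.fix K ζ =
      {x | x < lam.ord ∧ ∀ ξ < ζ, x ∈ G (WellFoundedLT.fix K ξ)} := fun ζ =>
    WellFoundedLT.fix_eq K ζ
  refine ⟨WellFoundedLT.fix K, fun ζ => ?_, hF⟩
  induction ζ using WellFoundedLT.induction with
  | ind ζ ih =>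
  intro hζ
  rw [hF ζ]
  exact isClubOf_forall_lt hreg hlam hζ fun ξ hξ => hG _ (ih ξ hξ (hξ.trans hζ))

/-- Along a decreasing chain the last points do not increase, so they reach a minimum and stay
there. A nonzero stable value lies in every club of the chain, hence in `F θ`; the value 0 may only
mean that no point exists. -/
theorem lastPoint_eventually_eq {γ θ α : Ordinal.{u}} (hθ : Order.IsSuccLimit θ) (hα : α < γ)
    {F : Ordinal.{u} → Set Ordinal.{u}} (hF : ∀ ζ < θ, IsClubOf (F ζ) γ) (hanti : Antitone F)
    (hinter : ∀ x < γ, (∀ ζ < θ, x ∈ F ζ) → x ∈ F θ) :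
    ∃ ζ < θ, ∀ ξ < θ, ζ ≤ ξ → lastPoint (F ξ) α = lastPoint (F θ) α := by
  have hne : ((fun ζ => lastPoint (F ζ) α) '' Iio θ).Nonempty := ⟨_, 0, hθ.bot_lt, rfl⟩
  obtain ⟨ζ, hζ, hv⟩ := csInf_mem hne
  have hmin : ∀ ξ < θ, lastPoint (F ζ) α ≤ lastPoint (F ξ) α := fun ξ hξ =>
    hv.trans_le (csInf_le' ⟨ξ, hξ, rfl⟩)
  have heq : ∀ ξ < θ, ζ ≤ ξ → lastPoint (F ξ) α = lastPoint (F ζ) α := fun ξ hξ h =>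
    (lastPoint_mono (hanti h) α).antisymm (hmin ξ hξ)
  refine ⟨ζ, hζ, fun ξ hξ h => (heq ξ hξ h).trans (le_antisymm ?_ (lastPoint_mono (hanti hζ.le) α))⟩
  by_cases h0 : lastPoint (F ζ) α = 0
  · rw [h0]
    exact bot_le
  · refine le_lastPoint (hinter _ ((lastPoint_le _ α).trans_lt hα) fun ξ hξ => ?_) (lastPoint_le _ α)
    have hm : max ξ ζ < θ := max_lt hξ hζ
    refine hanti (le_max_left ξ ζ) ?_
    rw [← heq _ hm (le_max_right _ _)] at h0 ⊢
    exact lastPoint_mem (hF _ hm) hα h0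

theorem exists_lift_eq_otp {μ : Cardinal.{u}} {B : Set Ordinal.{u}}
    (hB : #B < Cardinal.lift.{u + 1} μ) : ∃ η < μ.ord, Ordinal.lift.{u + 1} η = otp B := by
  have h : otp B < Ordinal.lift.{u + 1} μ.ord := by
    rw [Cardinal.lift_ord, Cardinal.lt_ord]
    exact hB
  exact Ordinal.lt_lift_iff.1 h

/-- In the system of approximations `a β i = f β '' Iio i ∩ Iio β`, some approximation of `δ`
contains a given small set, coheres at its elements, and is closed under a regressive function. -/
theorem exists_coherent_approximation {μ : Cardinal.{u}} (hreg : μ.ord.cof = μ) (hμ : ℵ₀ < μ)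
    {f : Ordinal.{u} → Ordinal.{u} → Ordinal.{u}} {δ : Ordinal.{u}}
    (hf : ∀ β ≤ δ, Iio β ⊆ f β '' Iio μ.ord)
    {s : Ordinal.{u} → Ordinal.{u}} (hs : ∀ α, s α ≤ α) {C : Set Ordinal.{u}} (hCδ : C ⊆ Iio δ)
    (hC : #C < Cardinal.lift.{u + 1} μ) :
    ∃ i < μ.ord, C ⊆ f δ '' Iio i ∩ Iio δ ∧ ∀ β ∈ f δ '' Iio i ∩ Iio δ,
      f β '' Iio i ∩ Iio β = f δ '' Iio i ∩ Iio β ∧ s β ∈ f δ '' Iio i ∩ Iio δ := by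
  have hlim : Order.IsSuccLimit μ.ord := isSuccLimit_ord hμ.le
  let a : Ordinal.{u} → Ordinal.{u} → Set Ordinal.{u} := fun β i => f β '' Iio i ∩ Iio β
  have hmono : ∀ {β i j}, i ≤ j → a β i ⊆ a β j := fun h =>
    inter_subset_inter_left _ (image_mono (Iio_subset_Iio h))
  have hev : ∀ β ≤ δ, ∀ x < β, ∃ i < μ.ord, ∀ j < μ.ord, i ≤ j → x ∈ a β j := by
    intro β hβ x hx
    obtain ⟨k, hk, hkx⟩ := hf β hβ hx
    exact ⟨Order.succ k, hlim.succ_lt hk, fun j _ hj =>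
      hmono hj ⟨⟨k, Order.lt_succ k, hkx⟩, hx⟩⟩
  have hsmall : ∀ β, ∀ i < μ.ord, #(a β i) < Cardinal.lift.{u + 1} μ := fun β i hi =>
    (mk_le_mk_of_subset inter_subset_left).trans_lt (mk_image_le.trans_lt (mk_Iio_lt_lift hi))
  obtain ⟨i₀, hi₀, hCi₀⟩ := exists_forall_of_eventually hreg hC
    (p := fun x j => x ∈ a δ j) fun x hx => hev δ le_rfl x (hCδ hx)
  -- Each requirement concerns fewer than μ points, so regularity gives one later index meeting all
  -- of them. At the limit of ω such steps the inclusions become equalities.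
  have hstep : ∀ i < μ.ord, ∃ j < μ.ord, i < j ∧ ∀ β ∈ a δ i,
      a β i ⊆ a δ j ∧ (∀ x ∈ a δ i, x < β → x ∈ a β j) ∧ s β ∈ a δ j := by
    intro i hi
    obtain ⟨j, hj, hjp⟩ := exists_forall_of_eventually hreg (hsmall δ i hi)
      (p := fun β j => a β i ⊆ a δ j ∧ (∀ x ∈ a δ i, x < β → x ∈ a β j) ∧ s β ∈ a δ j) (by
        intro β hβ
        have hβδ : β < δ := hβ.2
        obtain ⟨j₁, hj₁, h₁⟩ := exists_forall_of_eventually hreg (hsmall β i hi)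
          (p := fun x j => x ∈ a δ j) fun x hx => hev δ le_rfl x (lt_trans hx.2 hβδ)
        obtain ⟨j₂, hj₂, h₂⟩ := exists_forall_of_eventually hreg (A := a δ i ∩ Iio β)
          ((mk_le_mk_of_subset inter_subset_left).trans_lt (hsmall δ i hi))
          (p := fun x j => x ∈ a β j) fun x hx => hev β hβδ.le x hx.2
        obtain ⟨j₃, hj₃, h₃⟩ := hev δ le_rfl (s β) ((hs β).trans_lt hβδ)
        refine ⟨max (max j₁ j₂) j₃, max_lt (max_lt hj₁ hj₂) hj₃, fun j hj hle => ⟨?_, ?_, ?_⟩⟩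
        · exact h₁ j hj (((le_max_left _ _).trans (le_max_left _ _)).trans hle)
        · exact fun x hx hxβ =>
            h₂ j hj (((le_max_right _ _).trans (le_max_left _ _)).trans hle) x ⟨hx, hxβ⟩
        · exact h₃ j hj ((le_max_right _ _).trans hle))
    have hm : max (Order.succ i) j < μ.ord := max_lt (hlim.succ_lt hi) hj
    exact ⟨_, hm, (Order.lt_succ i).trans_le (le_max_left _ _), hjp _ hm (le_max_right _ _)⟩
  obtain ⟨t, ht0, ht, i, hi, hti, hit⟩ := exists_closure_point hreg hμ hstep hi₀
  have htmono : Monotone t := monotone_nat_of_le_succ fun n => (ht n).2.1.le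
  have hcont : ∀ {β x}, x ∈ a β i → ∃ n, ∀ m, n ≤ m → x ∈ a β (t m) := by
    rintro β x ⟨⟨k, hk, rfl⟩, hx⟩
    obtain ⟨n, hn⟩ := hit k hk
    exact ⟨n, fun m hm => ⟨⟨k, hn.trans_le (htmono hm), rfl⟩, hx⟩⟩
  refine ⟨i, hi, fun x hx => hmono (hti 0).le (hCi₀ _ (ht 0).1 ht0.ge x hx), fun β hβ => ⟨?_, ?_⟩⟩
  · obtain ⟨n, hn⟩ := hcont hβ
    refine Subset.antisymm (fun x hx => ?_) fun x hx => ?_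
    · obtain ⟨m, hm⟩ := hcont hx
      have h := ((ht (max n m)).2.2 β (hn _ (le_max_left _ _))).1 (hm _ (le_max_right _ _))
      exact ⟨(hmono (hti _).le h).1, hx.2⟩
    · obtain ⟨m, hm⟩ := hcont (β := δ) ⟨hx.1, lt_trans (mem_Iio.1 hx.2) hβ.2⟩
      have h := ((ht (max n m)).2.2 β (hn _ (le_max_left _ _))).2.1 x (hm _ (le_max_right _ _)) hx.2
      exact hmono (hti _).le h
  · obtain ⟨n, hn⟩ := hcont hβ
    exact hmono (hti _).le ((ht n).2.2 β (hn n le_rfl)).2.2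

/-! ### The successor case. -/

/-- The case of the successor of a regular uncountable cardinal. -/
theorem exists_guessingFamilies_succ {μ : Cardinal.{u}} {δs : Ordinal.{u}}
    (hδs : Order.IsSuccLimit δs) (hreg : μ.ord.cof = μ) (hμ : ℵ₀ < μ) (hδμ : δs < μ.ord) :
    ∃ (S : Set Ordinal.{u}) (P₁ P₂ : Ordinal.{u} → Set (Set Ordinal.{u})),
      IsStationaryIn S (Order.succ μ).ord ∧
      S ⊆ {δ | δ < (Order.succ μ).ord ∧ δ.cof = δs.cof} ∧
      GuessingFamilies (Order.succ μ) δs S P₁ P₂ := by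
  obtain ⟨lam, hlamdef⟩ : ∃ lam, lam = Order.succ μ := ⟨_, rfl⟩
  rw [← hlamdef]
  have hμlam : μ < lam := hlamdef ▸ Order.lt_succ μ
  have hlam : ℵ₀ < lam := hμ.trans hμlam
  have hlreg : lam.ord.cof = lam := hlamdef ▸ (isRegular_succ hμ.le).cof_ord
  have hμord : μ.ord < lam.ord := ord_lt_ord.2 hμlam
  have hμlim : Order.IsSuccLimit μ.ord := isSuccLimit_ord hμ.le
  have hf : ∀ β : Ordinal.{u}, ∃ f : Ordinal.{u} → Ordinal.{u},
      β < lam.ord → Iio β ⊆ f '' Iio μ.ord := by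
    intro β
    by_cases hβ : β < lam.ord
    · obtain ⟨f, hf⟩ := exists_Iio_subset_image (μ := μ) (β := β) (by
        rwa [Cardinal.lt_ord, hlamdef, Order.lt_succ_iff] at hβ)
      exact ⟨f, fun _ => hf⟩
    · exact ⟨id, fun h => absurd h hβ⟩
  choose f hf using hf
  obtain ⟨T, hT⟩ := exists_selector (Ordinal.lift.{u + 1} δs)
  -- For fixed `E` and `β` the two parameters range below μ, so `R E β` has fewer than `lam`
  -- members.
  let g : Set Ordinal.{u} → Ordinal.{u} → Ordinal.{u} → Ordinal.{u} → Set Ordinal.{u} :=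
    fun E β i η => clBelow (select (lastPoints E (f β '' Iio i ∩ Iio β)) (T η)) β
  let R : Set Ordinal.{u} → Ordinal.{u} → Set (Set Ordinal.{u}) := fun E β =>
    image2 (g E β) (Iio μ.ord) (Iio μ.ord)
  let W : Set Ordinal.{u} → Set (Set Ordinal.{u}) := fun E =>
    image2 (fun β (p : Ordinal.{u} × Ordinal.{u}) => g E β p.1 p.2) (Iio lam.ord)
      (image2 Prod.mk (Iio μ.ord) (Iio μ.ord))
  by_contra hcon
  have hbad : ∀ E, ∃ G, IsClubOf G lam.ord ∧ ∀ C ∈ W E, ∀ δ < lam.ord, C ⊆ G → IsClubOf C δ →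
      otp C = Ordinal.lift.{u + 1} δs → ∃ β ∈ nacc C, C ∩ Iio β ∉ R E β := by
    intro E
    by_contra! hE
    refine hcon (exists_guessingFamilies hδs (R E) (W E) (fun α _ => ?_) ?_ fun G hG => ?_)
    · exact mk_image2_lt hlam.le (mk_Iio_lt_lift hμord) (mk_Iio_lt_lift hμord)
    · refine mk_image2_le hlam.le ?_ (mk_image2_le hlam.le (mk_Iio_lt_lift hμord).le
        (mk_Iio_lt_lift hμord).le)
      rw [Cardinal.mk_Iio_ordinal, card_ord]
    · obtain ⟨C, hC, δ, hδ, h⟩ := hE G hG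
      exact ⟨C, hC, δ, hδ, h⟩
  choose G hGclub hG using hbad
  obtain ⟨F, hFclub, hF⟩ := exists_decreasing_clubs hlreg hlam fun E _ => hGclub E
  have hFanti : Antitone F := by
    intro ζ ξ h x hx
    rw [hF] at hx ⊢
    exact ⟨hx.1, fun ν hν => hx.2 ν (hν.trans_le h)⟩
  have hFlt : ∀ {ζ x}, x ∈ F ζ → x < lam.ord := fun {ζ x} hx => by
    rw [hF] at hx
    exact hx.1
  have hFG : ∀ {ζ}, ζ < μ.ord → F μ.ord ⊆ G (F ζ) := fun {ζ} hζ x hx => by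
    rw [hF] at hx
    exact hx.2 ζ hζ
  -- Only normality is needed here, hence the trivial growth condition.
  obtain ⟨b, hb⟩ := exists_normal_sequence hlreg hlam (hFclub _ hμord) (fun _ => 0)
    (fun _ => (isSuccLimit_ord hlam.le).bot_lt) ∅ (by simpa using hlam.pos)
  have hδslam : δs < lam.ord := hδμ.trans hμord
  obtain ⟨δ, hδ⟩ : ∃ δ, δ = b δs := ⟨_, rfl⟩
  have hδlam : δ < lam.ord := hδ ▸ hFlt (hb _ hδslam).1
  obtain ⟨i, hi, hCi, hcoh⟩ := exists_coherent_approximation hreg hμ (f := f) (δ := δ)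
    (fun β hβ => hf β (hβ.trans_lt hδlam)) (lastPoint_le (F μ.ord)) (C := b '' Iio δs)
    (by rintro _ ⟨k, hk, rfl⟩; exact hδ ▸ (hb _ hδslam).2.2.1 k hk)
    (mk_image_le.trans_lt (mk_Iio_lt_lift hδμ))
  obtain ⟨A, hA⟩ : ∃ A, A = f δ '' Iio i ∩ Iio δ := ⟨_, rfl⟩
  rw [← hA] at hCi hcoh
  have hAδ : A ⊆ Iio δ := hA ▸ inter_subset_right
  have hAcard : #A < Cardinal.lift.{u + 1} μ := hA ▸
    (mk_le_mk_of_subset inter_subset_left).trans_lt (mk_image_le.trans_lt (mk_Iio_lt_lift hi))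
  -- As `A` has fewer than μ points, a single ζ < μ stabilizes all their last points. Then `F ζ`
  -- computes `B`, while `B ⊆ F μ.ord ⊆ G (F ζ)`.
  obtain ⟨ζ, hζ, hstab⟩ := exists_forall_of_eventually hreg hAcard
    (p := fun α ξ => lastPoint (F ξ) α = lastPoint (F μ.ord) α) fun α hα =>
      lastPoint_eventually_eq hμlim (lt_trans (hAδ hα) hδlam)
        (fun ξ hξ => hFclub ξ (hξ.trans hμord)) hFanti fun x hx h => by
          rw [hF]
          refine ⟨hx, fun ξ hξ => ?_⟩
          have := h _ (hμlim.succ_lt hξ)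
          rw [hF] at this
          exact this.2 ξ (Order.lt_succ ξ)
  replace hstab := hstab ζ hζ le_rfl
  have hlast : ∀ A' ⊆ A, lastPoints (F ζ) A' = lastPoints (F μ.ord) A' := fun A' hA' => by
    rw [lastPoints, lastPoints, image_congr fun x hx => hstab x (hA' hx)]
  obtain ⟨B, hB⟩ : ∃ B, B = lastPoints (F μ.ord) A := ⟨_, rfl⟩
  have hBA : B ⊆ A := by
    rw [hB]
    rintro _ ⟨⟨x, hx, rfl⟩, -⟩
    exact (hcoh x hx).2
  have hBF : B ⊆ F μ.ord := by
    rw [hB]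
    rintro _ ⟨⟨x, hx, rfl⟩, h0⟩
    exact lastPoint_mem (hFclub _ hμord) (lt_trans (hAδ hx) hδlam) h0
  have hCB : b '' Iio δs ⊆ B := by
    rintro _ ⟨k, hk, rfl⟩
    have hbk := hb k (lt_trans hk hδslam)
    rw [hB]
    exact ⟨⟨b k, hCi ⟨k, hk, rfl⟩, lastPoint_eq_self hbk.1⟩, hbk.2.1.ne'⟩
  -- The crux: below each of its points, `B` is recovered from `f β`, `i` and `F ζ`, without
  -- reference to δ.
  have hBinit : ∀ β ∈ B, B ∩ Iio β = lastPoints (F ζ) (f β '' Iio i ∩ Iio β) := by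
    intro β hβ
    have hβA := hBA hβ
    have heq : f β '' Iio i ∩ Iio β = A ∩ Iio β := by
      rw [(hcoh β hβA).1, hA, inter_assoc, Iio_inter_Iio, min_eq_right (le_of_lt (hAδ hβA))]
    rw [heq, hlast _ inter_subset_left]
    refine Subset.antisymm ?_ ?_
    · rintro x ⟨hxB, hxβ⟩
      have hx0 : x ≠ 0 := by
        rw [hB] at hxB
        exact hxB.2
      exact ⟨⟨x, ⟨hBA hxB, hxβ⟩, lastPoint_eq_self (hBF hxB)⟩, hx0⟩
    · rintro _ ⟨⟨x, hx, rfl⟩, h0⟩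
      exact ⟨hB ▸ ⟨⟨x, hx.1, rfl⟩, h0⟩, (lastPoint_le _ x).trans_lt hx.2⟩
  obtain ⟨η, hη, hηB⟩ := exists_lift_eq_otp ((mk_le_mk_of_subset hBA).trans_lt hAcard)
  have hbcof : ∀ x < δ, ∃ c ∈ b '' Iio δs, x < c := by
    intro x hx
    obtain ⟨k, hk, hxk⟩ := (hb _ hδslam).2.2.2.2 hδs x (hδ ▸ hx)
    exact ⟨b k, ⟨k, hk, rfl⟩, hxk⟩
  obtain ⟨hDotp, hDcof⟩ := hT η B (b '' Iio δs) hηB.symm hCB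
    ((otp_image fun k _ j hj hkj => (hb j (lt_trans hj hδslam)).2.2.1 k hkj).trans (otp_Iio δs))
    fun x hx => hbcof x (hAδ (hBA hx))
  have hDB : select B (T η) ⊆ B := sep_subset _ _
  have hDδ : select B (T η) ⊆ Iio δ := hDB.trans (hBA.trans hAδ)
  have hDcof' : ∀ x < δ, ∃ c ∈ select B (T η), x < c := by
    intro x hx
    obtain ⟨c, hc, hxc⟩ := hbcof x hx
    obtain ⟨d, hd, hcd⟩ := hDcof c (hCB hc)
    exact ⟨d, hd, hxc.trans hcd⟩
  have hCeq : clBelow (select B (T η)) δ = g (F ζ) δ i η := by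
    simp only [g]
    rw [← hA, hlast A subset_rfl, ← hB]
  obtain ⟨β, hβ, hβR⟩ := hG (F ζ) (clBelow (select B (T η)) δ)
    ⟨δ, hδlam, (i, η), ⟨i, hi, η, hη, rfl⟩, hCeq.symm⟩ δ hδlam
    (clBelow_subset (hGclub _) hδlam.le (hDB.trans (hBF.trans (hFG hζ))))
    (isClubOf_clBelow hDδ fun x hx => (hDcof' x hx).imp fun c hc => ⟨hc.1, hc.2.le⟩)
    ((otp_clBelow hDδ hDcof').trans hDotp)
  -- The same `i` and `η` code the initial segment; `η` remains the order type of the whole of `B`.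
  refine hβR ⟨i, hi, η, hη, ?_⟩
  rw [clBelow_inter_Iio (le_of_lt hβ.1.1), select_inter_Iio, hBinit β (hDB (nacc_clBelow hβ))]

/-! ### Combining the two cases. -/

theorem mainTheorem6 (lam : Cardinal.{u}) (δs : Ordinal.{u}) (hδs : Order.IsSuccLimit δs)
    (hreg : lam.ord.cof = lam) (hlam : Order.succ δs.card < lam) :
    ∃ (S : Set Ordinal.{u}) (P₁ P₂ : Ordinal.{u} → Set (Set Ordinal.{u})),
      IsStationaryIn S lam.ord ∧
      S ⊆ {δ | δ < lam.ord ∧ δ.cof = δs.cof} ∧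
      GuessingFamilies lam δs S P₁ P₂ := by
  have hκ : ℵ₀ ≤ δs.card := by
    rw [Ordinal.aleph0_le_card]
    exact omega0_le_of_isSuccLimit hδs
  have hμ : ℵ₀ < Order.succ δs.card := hκ.trans_lt (Order.lt_succ _)
  obtain ⟨S, P₁, P₂, hS, hSsub, hP⟩ := exists_guessingFamilies_succ hδs
    (isRegular_succ hκ).cof_ord hμ (Cardinal.lt_ord.2 (Order.lt_succ _))
  rcases (Order.succ_le_of_lt hlam).eq_or_lt with rfl | hlt
  · exact ⟨S, P₁, P₂, hS, hSsub, hP⟩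
  · have hτ : ℵ₀ < Order.succ (Order.succ δs.card) := hμ.trans (Order.lt_succ _)
    refine exists_guessingFamilies_of_guessing hδs hreg (isRegular_succ hμ.le).cof_ord hτ hlt
      -- All guesses at τ = μ⁺ are pooled; there are at most τ · τ = τ < λ of them.
      (⋃ δ ∈ Iio (Order.succ (Order.succ δs.card)).ord, P₂ δ) ?_ fun F hF => ?_
    · refine lt_of_le_of_lt ?_ (Cardinal.lift_lt.2 hlt)
      have h : ⨆ δ : Iio (Order.succ (Order.succ δs.card)).ord, #(P₂ δ) ≤
          Cardinal.lift.{u + 1} (Order.succ (Order.succ δs.card)) :=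
        ciSup_le' fun δ => hP.card_snd δ δ.2
      refine (mk_biUnion_le _ _).trans ((mul_le_mul' ?_ h).trans
        (mul_eq_self (Cardinal.aleph0_le_lift.2 hτ.le)).le)
      rw [Cardinal.mk_Iio_ordinal, card_ord]
    · obtain ⟨δ, ⟨hδF, -⟩, -, C, hC, hCF⟩ := hP.guess F hF
      have hδ := hF.1 hδF
      exact ⟨C, mem_biUnion hδ hC, δ, hδ, hCF, hP.club_snd δ hδ C hC, hP.otp_snd δ hδ C hC⟩
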